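/- Let $A\in\mathbb R^{n\times d}$ be a nonzero matrix with rows $a_1^{T},\dots,a_n^{T}$. Write $\|\cdot\|$ for the Euclidean norm of vectors and for the spectral norm $\|M\|=\max_{\|x\|=1}\|Mx\|$ of matrices, and put $\|A\|_F^2=\sum_{i=1}^n\|a_i\|^2$ and $p_i=\|a_i\|^2/\|A\|_F^2$. For an integer $r\ge 1$ let $Z$ be the random vector that takes the value $a_i/\sqrt{r p_i}$ with probability $p_i$ ($1\le i\le n$, $p_i>0$), let $z_1,\dots,z_r$ be independent copies of $Z$, and let $\tilde A=[z_1,\dots,z_r]^{T}\in\mathbb R^{r\times d}$. Let $0<\varepsilon\le 1$ and $\delta>0$. If $$r\ \ge\ \frac{4d}{\varepsilon^2}\,\ln\frac{2d}{\delta},$$ then with probability at least $1-\delta$, $$(1-\varepsilon)\|A\|^2\ \le\ \|\tilde A\|^2\ \le\ (1+\varepsilon)\|A\|^2 .$$ -/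

import Mathlib

open MeasureTheory ProbabilityTheory
open scoped Matrix.Norms.L2Operator

noncomputable section

/-- The `i`-th row `aᵢ` of `A`, as a vector of Euclidean space. -/
def rowVec {n d : ℕ} (A : Matrix (Fin n) (Fin d) ℝ) (i : Fin n) : EuclideanSpace ℝ (Fin d) :=
  WithLp.toLp 2 (A i)

/-- The squared Frobenius norm, the sum of the squared Euclidean norms of the rows. -/
def frobeniusSq {n d : ℕ} (A : Matrix (Fin n) (Fin d) ℝ) : ℝ :=
  ∑ i, ‖rowVec A i‖ ^ 2

/-- The row-norm sampling probabilities `pᵢ = ‖aᵢ‖² / ‖A‖_F²`. -/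
def rowProb {n d : ℕ} (A : Matrix (Fin n) (Fin d) ℝ) (i : Fin n) : ℝ :=
  ‖rowVec A i‖ ^ 2 / frobeniusSq A

/-- The law of the random vector `Z` that takes the value `aᵢ / √(r pᵢ)` with probability `pᵢ`.
A zero row has `pᵢ = 0`, so it carries no mass and its value is irrelevant. -/
def rowSamplingLaw {n d : ℕ} (A : Matrix (Fin n) (Fin d) ℝ) (r : ℕ) :
    Measure (EuclideanSpace ℝ (Fin d)) :=
  ∑ i, ENNReal.ofReal (rowProb A i) •
    Measure.dirac ((Real.sqrt ((r : ℝ) * rowProb A i))⁻¹ • rowVec A i)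

/-- The `r × d` matrix whose rows are `z₁, …, z_r`. -/
def matrixOfRows {r d : ℕ} (z : Fin r → EuclideanSpace ℝ (Fin d)) : Matrix (Fin r) (Fin d) ℝ :=
  Matrix.of fun k j => z k j

end

/-!
The matrix `Ãᵀ Ã = ∑ₖ zₖ zₖᵀ` is a sum of independent rank-one matrices with mean `Aᵀ A`, and
row-norm sampling gives all `zₖ` the same squared length `‖A‖_F² / r`. Both tails of
`‖Ã‖² = λ_max (Ãᵀ Ã)` follow from Chernoff's method, applied to a potential of the partial sums that
grows in expectation by a controlled factor at each sample (`lintegral_pi_add_sum_le`,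
`measureReal_le_of_one_step`).

*Upper tail.* The potential is `tr exp`, as in the argument of Ahlswede and Winter. That argument
needs the Golden–Thompson inequality, here only for a perturbation `c v vᵀ` with `v` a unit vector,
where it has an elementary proof (`trace_exp_add_rankOne_le`). In the expansion of
`tr (S + c v vᵀ)ᵏ` a word in which `v vᵀ` occurs has as its trace a product of moments `v ⬝ Sᵃ v`;
by Chebyshev's inequality for the spectral measure of `S` at `v` this product is at most the single
moment of the total degree, which is the value obtained if `v vᵀ` is replaced by the scalar `1`.
Hence `tr exp (S + c v vᵀ) ≤ tr exp S + (e^c - 1) v ⬝ (exp S) v`. Averaging over the sampled row, and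
using `tr (A E Aᵀ) ≤ ‖A‖² tr E`, bounds the growth factor by `1 + (e^c - 1) ‖A‖² / ‖A‖_F²`
(`sum_rowProb_trace_exp_le`). The initial value `tr exp 0 = d` is the dimensional factor.

*Lower tail.* Only `‖Ã x‖²` for the top right singular vector `x` of `A` has to be bounded from
below. This is a sum of independent bounded scalars with mean `‖A‖²` (`sum_rowProb_exp_neg_le`).

Both failure probabilities are at most `d exp (-(r ‖A‖² / ‖A‖_F²) ε² / 4)`, and
`‖A‖_F² ≤ d ‖A‖²` turns the assumed lower bound on `r` into `δ / 2` for each.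
-/

open Matrix NormedSpace

/-! ### Functions of a positive semidefinite matrix -/

section SpectralCalculus

variable {m : Type*} [Fintype m] [DecidableEq m]

/-- The quadratic form of `U diag(g) Uᵀ` in the coordinates `Uᵀ x`. -/
lemma dotProduct_conj_diagonal (U : Matrix m m ℝ) (g x : m → ℝ) :
    x ⬝ᵥ (U * diagonal g * Uᵀ) *ᵥ x = ∑ i, g i * (Uᵀ *ᵥ x) i ^ 2 := by
  rw [← mulVec_mulVec, ← mulVec_mulVec, dotProduct_mulVec, ← mulVec_transpose]
  simp only [dotProduct, mulVec_diagonal]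
  exact Finset.sum_congr rfl fun i _ => by ring

lemma trace_conj_diagonal {U : Matrix m m ℝ} (hU : Uᵀ * U = 1) (g : m → ℝ) :
    (U * diagonal g * Uᵀ).trace = ∑ i, g i := by
  rw [trace_mul_comm, ← mul_assoc, hU, one_mul, trace_diagonal]

lemma conj_diagonal_mul {U : Matrix m m ℝ} (hU : Uᵀ * U = 1) (g h : m → ℝ) :
    (U * diagonal g * Uᵀ) * (U * diagonal h * Uᵀ) =
      U * diagonal (fun i => g i * h i) * Uᵀ := by
  calc _ = U * diagonal g * (Uᵀ * U) * diagonal h * Uᵀ := by simp only [mul_assoc]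
    _ = _ := by rw [hU, mul_one, mul_assoc U, diagonal_mul_diagonal]

lemma conj_diagonal_pow {U : Matrix m m ℝ} (hU : Uᵀ * U = 1) (g : m → ℝ) (k : ℕ) :
    (U * diagonal g * Uᵀ) ^ k = U * diagonal (fun i => g i ^ k) * Uᵀ := by
  induction k with
  | zero =>
    have hU' : U * Uᵀ = 1 := mul_eq_one_comm.mp hU
    simp [hU']
  | succ k ih => rw [pow_succ, ih, conj_diagonal_mul hU]; simp only [pow_succ]

lemma conj_diagonal_exp {U : Matrix m m ℝ} (hU : Uᵀ * U = 1) (g : m → ℝ) :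
    exp (U * diagonal g * Uᵀ) = U * diagonal (fun i => Real.exp (g i)) * Uᵀ := by
  have hU' : U * Uᵀ = 1 := mul_eq_one_comm.mp hU
  have hinv : U⁻¹ = Uᵀ := inv_eq_right_inv hU'
  have h := Matrix.exp_conj U (diagonal g) (IsUnit.of_mul_eq_one _ hU')
  rw [hinv] at h
  rw [h, Matrix.exp_diagonal]
  congr 3
  ext i
  rw [Pi.coe_exp, Real.exp_eq_exp_ℝ]

lemma conj_diagonal_add_smul_one {U : Matrix m m ℝ} (hU : Uᵀ * U = 1) (g : m → ℝ) (c : ℝ) :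
    U * diagonal g * Uᵀ + c • (1 : Matrix m m ℝ) = U * diagonal (fun i => g i + c) * Uᵀ := by
  have hU' : U * Uᵀ = 1 := mul_eq_one_comm.mp hU
  have h : diagonal (fun i => g i + c) = diagonal g + c • (1 : Matrix m m ℝ) := by
    ext i j
    by_cases hij : i = j <;> simp [hij]
  rw [h, mul_add, add_mul]
  simp [hU']

lemma sum_sq_transpose_mulVec {U : Matrix m m ℝ} (hU : Uᵀ * U = 1) (x : m → ℝ) :
    ∑ i, (Uᵀ *ᵥ x) i ^ 2 = x ⬝ᵥ x := by
  have hU' : U * Uᵀ = 1 := mul_eq_one_comm.mp hU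
  have h := dotProduct_conj_diagonal U (fun _ => (1 : ℝ)) x
  rw [diagonal_one, mul_one, hU', one_mulVec] at h
  simpa using h.symm

/-- A real positive semidefinite matrix is orthogonally diagonalisable with nonnegative
eigenvalues. -/
lemma Matrix.PosSemidef.exists_orthogonal_diagonal {S : Matrix m m ℝ} (hS : S.PosSemidef) :
    ∃ (U : Matrix m m ℝ) (l : m → ℝ), Uᵀ * U = 1 ∧ (∀ i, 0 ≤ l i) ∧
      S = U * diagonal l * Uᵀ := by
  refine ⟨hS.1.eigenvectorUnitary, hS.1.eigenvalues, ?_, hS.eigenvalues_nonneg, ?_⟩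
  · have := Unitary.coe_star_mul_self hS.1.eigenvectorUnitary
    rwa [star_eq_conjTranspose, conjTranspose_eq_transpose_of_trivial] at this
  · have := hS.1.spectral_theorem
    rw [Unitary.conjStarAlgAut_apply, star_eq_conjTranspose,
      conjTranspose_eq_transpose_of_trivial] at this
    simpa using this

end SpectralCalculus

/-! ### The Golden–Thompson inequality for rank-one perturbations -/

section RankOneUpdate

variable {m : Type*} [Fintype m]

/-- Chebyshev's sum inequality for a probability weight `w` and two sequences that vary together. -/
lemma sum_mul_sum_le_sum_mul_of_monovary {w f g : m → ℝ} (hw : ∀ i, 0 ≤ w i)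
    (hw1 : ∑ i, w i = 1) (hfg : ∀ i j, 0 ≤ (f i - f j) * (g i - g j)) :
    (∑ i, f i * w i) * (∑ i, g i * w i) ≤ ∑ i, f i * g i * w i := by
  have h : 0 ≤ ∑ i, ∑ j, w i * w j * ((f i - f j) * (g i - g j)) :=
    Finset.sum_nonneg fun i _ => Finset.sum_nonneg fun j _ =>
      mul_nonneg (mul_nonneg (hw i) (hw j)) (hfg i j)
  have e : ∑ i, ∑ j, w i * w j * ((f i - f j) * (g i - g j)) =
      2 * ((∑ i, f i * g i * w i) * (∑ i, w i) - (∑ i, f i * w i) * (∑ i, g i * w i)) := by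
    have e1 : ∀ a b : m → ℝ, (∑ i, a i) * (∑ j, b j) = ∑ i, ∑ j, a i * b j :=
      fun a b => Finset.sum_mul_sum _ _ _ _
    have e2 : ∑ i, ∑ j, w i * w j * ((f i - f j) * (g i - g j)) =
        (∑ i, f i * g i * w i) * (∑ i, w i) - (∑ i, f i * w i) * (∑ i, g i * w i)
        - (∑ i, g i * w i) * (∑ i, f i * w i) + (∑ i, w i) * (∑ i, f i * g i * w i) := by
      simp only [e1, ← Finset.sum_sub_distrib, ← Finset.sum_add_distrib]
      exact Finset.sum_congr rfl fun i _ => Finset.sum_congr rfl fun j _ => by ring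
    rw [e2]; ring
  rw [e, hw1] at h
  linarith

variable [DecidableEq m] {S : Matrix m m ℝ} {v : m → ℝ} {c : ℝ}

/-- The factors `Sᵃ` and `(S + c)ᵇ` are increasing functions of `S`, hence positively correlated
under the spectral measure of `S` at a unit vector. -/
lemma dotProduct_pow_mul_dotProduct_pow_le (hS : S.PosSemidef) (hv : v ⬝ᵥ v = 1) (hc : 0 ≤ c)
    (a b : ℕ) :
    (v ⬝ᵥ (S ^ a) *ᵥ v) * (v ⬝ᵥ ((S + c • (1 : Matrix m m ℝ)) ^ b) *ᵥ v) ≤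
      v ⬝ᵥ (S ^ a * (S + c • (1 : Matrix m m ℝ)) ^ b) *ᵥ v := by
  obtain ⟨U, l, hU, hl, rfl⟩ := hS.exists_orthogonal_diagonal
  rw [conj_diagonal_add_smul_one hU, conj_diagonal_pow hU, conj_diagonal_pow hU,
    conj_diagonal_mul hU]
  simp only [dotProduct_conj_diagonal]
  refine sum_mul_sum_le_sum_mul_of_monovary (fun i => sq_nonneg _)
    ((sum_sq_transpose_mulVec hU v).trans hv) fun i j => ?_
  rcases le_total (l i) (l j) with h | h
  · exact mul_nonneg_of_nonpos_of_nonpos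
      (sub_nonpos.2 (pow_le_pow_left₀ (hl i) h a))
      (sub_nonpos.2 (pow_le_pow_left₀ (by linarith [hl i]) (by linarith) b))
  · exact mul_nonneg
      (sub_nonneg.2 (pow_le_pow_left₀ (hl j) h a))
      (sub_nonneg.2 (pow_le_pow_left₀ (by linarith [hl j]) (by linarith) b))

lemma dotProduct_pow_mulVec_nonneg (hS : S.PosSemidef) (a : ℕ) (x : m → ℝ) :
    0 ≤ x ⬝ᵥ (S ^ a) *ᵥ x := by
  simpa using (hS.pow a).dotProduct_mulVec_nonneg x

/-- In the quadratic form at `v`, replacing the rank-one perturbation `c v vᵀ` by the scalar `c`,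
which commutes with `S`, does not decrease powers. -/
lemma dotProduct_pow_mul_rankOne_pow_le (hS : S.PosSemidef) (hv : v ⬝ᵥ v = 1) (hc : 0 ≤ c)
    (a b : ℕ) :
    v ⬝ᵥ (S ^ a * (S + c • vecMulVec v v) ^ b) *ᵥ v ≤
      v ⬝ᵥ (S ^ a * (S + c • (1 : Matrix m m ℝ)) ^ b) *ᵥ v := by
  induction b generalizing a with
  | zero => simp
  | succ b ih =>
    have e1 : v ⬝ᵥ (S ^ a * (S + c • vecMulVec v v) ^ (b + 1)) *ᵥ v =
        v ⬝ᵥ (S ^ (a + 1) * (S + c • vecMulVec v v) ^ b) *ᵥ v +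
          c * ((v ⬝ᵥ (S ^ a) *ᵥ v) * (v ⬝ᵥ ((S + c • vecMulVec v v) ^ b) *ᵥ v)) := by
      rw [pow_succ' (S + _), ← mul_assoc, mul_add, add_mul, add_mulVec, dotProduct_add,
        ← pow_succ, mul_smul_comm, smul_mul_assoc, smul_mulVec, dotProduct_smul, smul_eq_mul,
        mul_vecMulVec, vecMulVec_mul, vecMulVec_mulVec, ← dotProduct_mulVec]
      simp
      left; ring
    have e2 : v ⬝ᵥ (S ^ a * (S + c • (1 : Matrix m m ℝ)) ^ (b + 1)) *ᵥ v =
        v ⬝ᵥ (S ^ (a + 1) * (S + c • (1 : Matrix m m ℝ)) ^ b) *ᵥ v +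
          c * (v ⬝ᵥ (S ^ a * (S + c • (1 : Matrix m m ℝ)) ^ b) *ᵥ v) := by
      rw [pow_succ' (S + _), ← mul_assoc, mul_add, add_mul, add_mulVec, dotProduct_add,
        ← pow_succ, mul_smul_comm, smul_mul_assoc, smul_mulVec, dotProduct_smul, smul_eq_mul,
        mul_one]
    have h0 := ih 0
    rw [pow_zero, one_mul, one_mul] at h0
    rw [e1, e2]
    refine add_le_add (ih _) (mul_le_mul_of_nonneg_left ?_ hc)
    exact (mul_le_mul_of_nonneg_left h0 (dotProduct_pow_mulVec_nonneg hS a v)).trans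
      (dotProduct_pow_mul_dotProduct_pow_le hS hv hc a b)

/-- The trace version of `dotProduct_pow_mul_rankOne_pow_le`: the terms of the expansion that contain
`v vᵀ` contribute at most the excess of `(S + c)ᵇ` over `Sᵇ` in the quadratic form at `v`. The factor
`Sᵃ` is carried along for the induction on `b`. -/
lemma trace_pow_mul_rankOne_pow_le (hS : S.PosSemidef) (hv : v ⬝ᵥ v = 1) (hc : 0 ≤ c)
    (a b : ℕ) :
    (S ^ a * (S + c • vecMulVec v v) ^ b).trace ≤ (S ^ (a + b)).trace +
      (v ⬝ᵥ (S ^ a * (S + c • (1 : Matrix m m ℝ)) ^ b) *ᵥ v - v ⬝ᵥ (S ^ (a + b)) *ᵥ v) := by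
  induction b generalizing a with
  | zero => simp
  | succ b ih =>
    have hT : ∀ k, (S ^ k)ᵀ = S ^ k := fun k => by
      simpa using (hS.pow k).isHermitian.eq
    have hHT : (S + c • vecMulVec v v)ᵀ = S + c • vecMulVec v v := by
      have := hT 1
      rw [pow_one] at this
      simp [this, transpose_vecMulVec]
    have e1 : (S ^ a * (S + c • vecMulVec v v) ^ (b + 1)).trace =
        (S ^ (a + 1) * (S + c • vecMulVec v v) ^ b).trace +
          c * (v ⬝ᵥ (S ^ a * (S + c • vecMulVec v v) ^ b) *ᵥ v) := by
      rw [pow_succ' (S + _), ← mul_assoc, mul_add, add_mul, trace_add,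
        ← pow_succ, mul_smul_comm, smul_mul_assoc, trace_smul, smul_eq_mul,
        mul_vecMulVec, vecMulVec_mul, trace_vecMulVec, ← mulVec_transpose, transpose_pow, hHT,
        ← mulVec_mulVec, dotProduct_mulVec v, ← mulVec_transpose, hT]
    have e2 : v ⬝ᵥ (S ^ a * (S + c • (1 : Matrix m m ℝ)) ^ (b + 1)) *ᵥ v =
        v ⬝ᵥ (S ^ (a + 1) * (S + c • (1 : Matrix m m ℝ)) ^ b) *ᵥ v +
          c * (v ⬝ᵥ (S ^ a * (S + c • (1 : Matrix m m ℝ)) ^ b) *ᵥ v) := by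
      rw [pow_succ' (S + _), ← mul_assoc, mul_add, add_mul, add_mulVec, dotProduct_add,
        ← pow_succ, mul_smul_comm, smul_mul_assoc, smul_mulVec, dotProduct_smul, smul_eq_mul,
        mul_one]
    have h1 := ih (a + 1)
    have h2 := mul_le_mul_of_nonneg_left (dotProduct_pow_mul_rankOne_pow_le hS hv hc a b) hc
    rw [show a + 1 + b = a + (b + 1) by ring] at h1
    rw [e1, e2]
    linarith

/-- A linear functional of the exponential, as the sum of its power series. -/
lemma hasSum_linearMap_exp (φ : Matrix m m ℝ →ₗ[ℝ] ℝ) (M : Matrix m m ℝ) :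
    HasSum (fun k : ℕ => (k.factorial : ℝ)⁻¹ * φ (M ^ k)) (φ (exp M)) := by
  have h := (exp_series_hasSum_exp' (𝕂 := ℝ) M).map φ φ.continuous_of_finiteDimensional
  simpa [Function.comp_def] using h

/-- The quadratic form `M ↦ v ⬝ M v` as a linear functional of the matrix. -/
def quadFormAt (v : m → ℝ) : Matrix m m ℝ →ₗ[ℝ] ℝ where
  toFun M := v ⬝ᵥ M *ᵥ v
  map_add' M N := by rw [add_mulVec, dotProduct_add]
  map_smul' c M := by rw [smul_mulVec, dotProduct_smul]; rfl

/-- The Golden–Thompson inequality `tr exp (S + c v vᵀ) ≤ tr (exp S · exp (c v vᵀ))` for a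
rank-one perturbation, `v` being a unit vector. -/
lemma trace_exp_add_rankOne_le (hS : S.PosSemidef) (hv : v ⬝ᵥ v = 1) (hc : 0 ≤ c) :
    (exp (S + c • vecMulVec v v)).trace ≤
      (exp S).trace + (Real.exp c - 1) * (v ⬝ᵥ (exp S) *ᵥ v) := by
  have hcomm : exp (S + c • (1 : Matrix m m ℝ)) = Real.exp c • exp S := by
    obtain ⟨U, l, hU, hl, rfl⟩ := hS.exists_orthogonal_diagonal
    rw [conj_diagonal_add_smul_one hU, conj_diagonal_exp hU, conj_diagonal_exp hU]
    have : diagonal (fun i => Real.exp (l i + c)) =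
        Real.exp c • diagonal (fun i => Real.exp (l i)) := by
      rw [← diagonal_smul]
      congr 1; ext i; simp [Real.exp_add, mul_comm]
    rw [this]; simp
  have h1 := hasSum_linearMap_exp (traceLinearMap m ℝ ℝ) (S + c • vecMulVec v v)
  have h2 := hasSum_linearMap_exp (traceLinearMap m ℝ ℝ) S
  have h3 := hasSum_linearMap_exp (quadFormAt v) (S + c • (1 : Matrix m m ℝ))
  have h4 := hasSum_linearMap_exp (quadFormAt v) S
  have h := hasSum_le (fun k => ?_) h1 (h2.add (h3.sub h4))
  · rw [hcomm, map_smul] at h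
    simp only [traceLinearMap_apply, quadFormAt, LinearMap.coe_mk, AddHom.coe_mk,
      smul_eq_mul] at h
    linarith
  · have := trace_pow_mul_rankOne_pow_le hS hv hc 0 k
    rw [pow_zero, one_mul, one_mul, zero_add] at this
    simp only [traceLinearMap_apply, quadFormAt, LinearMap.coe_mk, AddHom.coe_mk]
    rw [← mul_sub, ← mul_add]
    exact mul_le_mul_of_nonneg_left this (by positivity)

end RankOneUpdate

/-! ### The spectral norm and the top eigenvalue -/

section SpectralNorm

variable {k m : Type*} [Fintype k] [Fintype m]

lemma dotProduct_self_eq_norm_sq (x : m → ℝ) : x ⬝ᵥ x = ‖WithLp.toLp 2 x‖ ^ 2 := by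
  rw [EuclideanSpace.real_norm_sq_eq, dotProduct]
  exact Finset.sum_congr rfl fun i _ => by simp [sq]

lemma mulVec_dotProduct_self (B : Matrix k m ℝ) (x : m → ℝ) :
    (B *ᵥ x) ⬝ᵥ (B *ᵥ x) = x ⬝ᵥ (Bᵀ * B) *ᵥ x := by
  rw [← mulVec_mulVec, dotProduct_mulVec x, ← mulVec_transpose, transpose_transpose]

lemma posSemidef_transpose_mul_self (B : Matrix k m ℝ) : (Bᵀ * B).PosSemidef := by
  simpa using posSemidef_conjTranspose_mul_self B

variable [DecidableEq m]

lemma mulVec_dotProduct_self_le (B : Matrix k m ℝ) (x : m → ℝ) :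
    (B *ᵥ x) ⬝ᵥ (B *ᵥ x) ≤ ‖B‖ ^ 2 * (x ⬝ᵥ x) := by
  rw [dotProduct_self_eq_norm_sq, dotProduct_self_eq_norm_sq, ← mul_pow]
  exact pow_le_pow_left₀ (norm_nonneg _) (l2_opNorm_mulVec B (WithLp.toLp 2 x)) 2

lemma l2_opNorm_sq_le (B : Matrix k m ℝ) {t : ℝ} (ht : 0 ≤ t)
    (h : ∀ x, (B *ᵥ x) ⬝ᵥ (B *ᵥ x) ≤ t * (x ⬝ᵥ x)) : ‖B‖ ^ 2 ≤ t := by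
  rw [← Real.sq_sqrt ht]
  refine pow_le_pow_left₀ (norm_nonneg _) ?_ 2
  rw [l2_opNorm_def]
  refine ContinuousLinearMap.opNorm_le_bound _ (Real.sqrt_nonneg _) fun x => ?_
  have hx := h x
  rw [dotProduct_self_eq_norm_sq, dotProduct_self_eq_norm_sq] at hx
  refine le_of_sq_le_sq ?_ (by positivity)
  rw [mul_pow, Real.sq_sqrt ht]
  exact hx

/-- The squared spectral norm of `B` is the largest eigenvalue of `Bᵀ B`. -/
lemma exists_orthogonal_diagonal_l2_opNorm_sq_le [Nonempty m] (B : Matrix k m ℝ) :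
    ∃ (U : Matrix m m ℝ) (l : m → ℝ) (i : m), Uᵀ * U = 1 ∧
      Bᵀ * B = U * diagonal l * Uᵀ ∧ ‖B‖ ^ 2 ≤ l i := by
  obtain ⟨U, l, hU, hl, hB⟩ := (posSemidef_transpose_mul_self B).exists_orthogonal_diagonal
  obtain ⟨i, hi⟩ := Finite.exists_max l
  refine ⟨U, l, i, hU, hB, l2_opNorm_sq_le B (hl i) fun x => ?_⟩
  rw [mulVec_dotProduct_self, hB, dotProduct_conj_diagonal, ← sum_sq_transpose_mulVec hU,
    Finset.mul_sum]
  exact Finset.sum_le_sum fun j _ => mul_le_mul_of_nonneg_right (hi j) (sq_nonneg _)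

/-- The spectral norm is attained at a unit vector. -/
lemma exists_l2_opNorm_sq_le_mulVec [Nonempty m] (B : Matrix k m ℝ) :
    ∃ x : m → ℝ, x ⬝ᵥ x = 1 ∧ ‖B‖ ^ 2 ≤ (B *ᵥ x) ⬝ᵥ (B *ᵥ x) := by
  obtain ⟨U, l, i, hU, hB, hi⟩ := exists_orthogonal_diagonal_l2_opNorm_sq_le B
  have hx : Uᵀ *ᵥ (U *ᵥ Pi.single i 1) = Pi.single i 1 := by
    rw [mulVec_mulVec, hU, one_mulVec]
  refine ⟨U *ᵥ Pi.single i 1, ?_, hi.trans_eq ?_⟩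
  · rw [← sum_sq_transpose_mulVec hU, hx]
    simp [Pi.single_apply]
  · rw [mulVec_dotProduct_self, hB, dotProduct_conj_diagonal, hx]
    simp [Pi.single_apply]

lemma exp_l2_opNorm_sq_le_trace_exp [Nonempty m] (B : Matrix k m ℝ) (θ : ℝ) (hθ : 0 ≤ θ) :
    Real.exp (θ * ‖B‖ ^ 2) ≤ (exp (θ • (Bᵀ * B))).trace := by
  obtain ⟨U, l, i, hU, hB, hi⟩ := exists_orthogonal_diagonal_l2_opNorm_sq_le B
  have : θ • (Bᵀ * B) = U * diagonal (fun j => θ * l j) * Uᵀ := by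
    rw [hB, ← smul_mul_assoc, ← mul_smul_comm, ← diagonal_smul]; rfl
  rw [this, conj_diagonal_exp hU, trace_conj_diagonal hU]
  exact (Real.exp_le_exp.2 (mul_le_mul_of_nonneg_left hi hθ)).trans
    (Finset.single_le_sum (f := fun j => Real.exp (θ * l j))
      (fun j _ => (Real.exp_pos _).le) (Finset.mem_univ i))

lemma Matrix.PosSemidef.exp {S : Matrix m m ℝ} (hS : S.PosSemidef) :
    (NormedSpace.exp S).PosSemidef := by
  obtain ⟨U, l, hU, -, rfl⟩ := hS.exists_orthogonal_diagonal
  rw [conj_diagonal_exp hU]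
  have h : (diagonal fun i => Real.exp (l i)).PosSemidef :=
    PosSemidef.diagonal fun i => (Real.exp_pos _).le
  simpa using h.mul_mul_conjTranspose_same U

/-- `tr (B E Bᵀ) ≤ ‖B‖² tr E` for positive semidefinite `E`, the left side being written as a sum
over the rows of `B`. -/
lemma sum_row_dotProduct_mulVec_le (B : Matrix k m ℝ) {E : Matrix m m ℝ} (hE : E.PosSemidef) :
    ∑ i, B i ⬝ᵥ E *ᵥ B i ≤ ‖B‖ ^ 2 * E.trace := by
  obtain ⟨U, e, hU, he, rfl⟩ := hE.exists_orthogonal_diagonal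
  rw [trace_conj_diagonal hU, Finset.mul_sum]
  simp only [dotProduct_conj_diagonal]
  rw [Finset.sum_comm]
  refine Finset.sum_le_sum fun j _ => ?_
  rw [← Finset.mul_sum, mul_comm]
  refine mul_le_mul_of_nonneg_right ?_ (he j)
  have h := mulVec_dotProduct_self_le B (Uᵀ j)
  have h1 : Uᵀ j ⬝ᵥ Uᵀ j = 1 := by
    have := congrFun (congrFun hU j) j
    rwa [one_apply_eq] at this
  rw [h1, mul_one] at h
  refine le_of_eq_of_le ?_ h
  rw [dotProduct]
  refine Finset.sum_congr rfl fun i _ => ?_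
  rw [sq, mulVec, mulVec, dotProduct_comm]

end SpectralNorm

/-! ### Chernoff's method on a product measure -/

section ProductMeasure

open scoped ENNReal

/-- Iterating a one-step bound: if adding one random increment `Y x` multiplies the expectation of
`G` by at most `C`, then adding `N` independent ones multiplies it by at most `C ^ N`. The set `K`
holds the states at which the one-step bound is available. -/
lemma lintegral_pi_add_sum_le {E M : Type*} [MeasurableSpace E] [AddCommMonoid M]
    (μ : Measure E) [SigmaFinite μ] (Y : E → M) (G : M → ℝ≥0∞) (K : Set M) (C : ℝ≥0∞)
    (hmeas : ∀ (N : ℕ) (S : M), Measurable fun z : Fin N → E => G (S + ∑ k, Y (z k)))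
    (hK : ∀ S ∈ K, ∀ x, S + Y x ∈ K)
    (hstep : ∀ S ∈ K, ∫⁻ x, G (S + Y x) ∂μ ≤ C * G S) (N : ℕ) :
    ∀ S ∈ K, ∫⁻ z, G (S + ∑ k, Y (z k)) ∂(Measure.pi fun _ : Fin N => μ) ≤ C ^ N * G S := by
  induction N with
  | zero =>
    intro S _
    simp
  | succ N ih =>
    intro S hS
    have hmp := (measurePreserving_piFinSuccAbove (fun _ : Fin (N + 1) => μ) 0).symm
    rw [← hmp.lintegral_comp (hmeas (N + 1) S), lintegral_prod]
    · calc _ = ∫⁻ x, ∫⁻ z, G (S + Y x + ∑ k, Y (z k)) ∂(Measure.pi fun _ : Fin N => μ) ∂μ := by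
            refine lintegral_congr fun x => lintegral_congr fun z => ?_
            simp [MeasurableEquiv.piFinSuccAbove, Fin.sum_univ_succ, add_assoc]
        _ ≤ ∫⁻ x, C ^ N * G (S + Y x) ∂μ := lintegral_mono fun x => ih _ (hK S hS x)
        _ = C ^ N * ∫⁻ x, G (S + Y x) ∂μ := by
            refine lintegral_const_mul _ ?_
            have h1 : Measurable fun x : E => (fun _ : Fin 1 => x) :=
              measurable_pi_lambda _ fun _ => measurable_id
            simpa [Function.comp_def] using (hmeas 1 S).comp h1
        _ ≤ C ^ N * (C * G S) := mul_le_mul_right (hstep S hS) _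
        _ = C ^ (N + 1) * G S := by rw [pow_succ, mul_assoc]
    · exact ((hmeas (N + 1) S).comp (MeasurableEquiv.measurable _)).aemeasurable

/-- Markov's inequality for a set on which `f ≥ M`. -/
lemma measureReal_le_div_of_lintegral_le {Ω : Type*} [MeasurableSpace Ω] (P : Measure Ω)
    [IsFiniteMeasure P] {f : Ω → ℝ} (hf : AEMeasurable f P) {K M : ℝ} (hM : 0 < M) (hK : 0 ≤ K)
    (hint : ∫⁻ ω, ENNReal.ofReal (f ω) ∂P ≤ ENNReal.ofReal K) {s : Set Ω}
    (hs : ∀ ω ∈ s, M ≤ f ω) : P.real s ≤ K / M := by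
  have h1 := mul_meas_ge_le_lintegral₀ hf.ennreal_ofReal (ENNReal.ofReal M)
  have h2 : ENNReal.ofReal M * P s ≤ ENNReal.ofReal K :=
    le_trans (mul_le_mul_right (measure_mono fun ω hω => ENNReal.ofReal_le_ofReal (hs ω hω)) _)
      (h1.trans hint)
  have h3 := ENNReal.toReal_mono ENNReal.ofReal_ne_top h2
  rw [ENNReal.toReal_mul, ENNReal.toReal_ofReal hM.le, ENNReal.toReal_ofReal hK] at h3
  rw [le_div_iff₀ hM, mul_comm]
  exact h3

end ProductMeasure

/-! ### The row-norm sampling law -/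

section RowSampling

variable {n d : ℕ} (A : Matrix (Fin n) (Fin d) ℝ)

lemma norm_rowVec_sq (i : Fin n) : ‖rowVec A i‖ ^ 2 = A i ⬝ᵥ A i :=
  (dotProduct_self_eq_norm_sq (A i)).symm

lemma norm_rowVec_pos {i : Fin n} (hi : A i ≠ 0) : 0 < ‖rowVec A i‖ :=
  norm_pos_iff.2 fun h => hi (congrArg WithLp.ofLp h)

lemma frobeniusSq_pos (hA : A ≠ 0) : 0 < frobeniusSq A := by
  have h0 : 0 ≤ frobeniusSq A := Finset.sum_nonneg fun _ _ => sq_nonneg _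
  refine h0.lt_of_ne fun h => hA ?_
  have h1 := (Finset.sum_eq_zero_iff_of_nonneg fun _ _ => sq_nonneg _).1 h.symm
  ext i j
  have h2 := h1 i (Finset.mem_univ i)
  rw [norm_rowVec_sq, dotProduct_self_eq_zero] at h2
  exact congrFun h2 j

lemma frobeniusSq_le : frobeniusSq A ≤ d * ‖A‖ ^ 2 := by
  have h := sum_row_dotProduct_mulVec_le A (PosSemidef.one (n := Fin d) (R := ℝ))
  simp only [one_mulVec, trace_one, Fintype.card_fin] at h
  simpa only [frobeniusSq, norm_rowVec_sq, mul_comm] using h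

lemma rowProb_nonneg (i : Fin n) : 0 ≤ rowProb A i :=
  div_nonneg (sq_nonneg _) (Finset.sum_nonneg fun _ _ => sq_nonneg _)

lemma sum_rowProb (hA : A ≠ 0) : ∑ i, rowProb A i = 1 := by
  simp only [rowProb, ← Finset.sum_div]
  exact div_self (frobeniusSq_pos A hA).ne'

/-- The value `aᵢ / √(r pᵢ)` taken by the random vector. -/
noncomputable def sampleVec (r : ℕ) (i : Fin n) : EuclideanSpace ℝ (Fin d) :=
  (Real.sqrt ((r : ℝ) * rowProb A i))⁻¹ • rowVec A i

lemma lintegral_rowSamplingLaw (r : ℕ) (g : EuclideanSpace ℝ (Fin d) → ℝ) (hg : ∀ x, 0 ≤ g x) :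
    ∫⁻ x, ENNReal.ofReal (g x) ∂(rowSamplingLaw A r) =
      ENNReal.ofReal (∑ i, rowProb A i * g (sampleVec A r i)) := by
  rw [rowSamplingLaw, lintegral_finsetSum_measure, ENNReal.ofReal_sum_of_nonneg
    fun i _ => mul_nonneg (rowProb_nonneg A i) (hg _)]
  refine Finset.sum_congr rfl fun i _ => ?_
  rw [lintegral_smul_measure, lintegral_dirac, ENNReal.ofReal_mul (rowProb_nonneg A i)]
  rfl

/-- The rank-one matrix `θ x xᵀ`. -/
noncomputable def scaledOuter (θ : ℝ) (x : EuclideanSpace ℝ (Fin d)) : Matrix (Fin d) (Fin d) ℝ :=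
  θ • vecMulVec x.ofLp x.ofLp

lemma scaledOuter_posSemidef {θ : ℝ} (hθ : 0 ≤ θ) (x : EuclideanSpace ℝ (Fin d)) :
    (scaledOuter θ x).PosSemidef := by
  have h : (vecMulVec x.ofLp x.ofLp).PosSemidef := by
    simpa using posSemidef_vecMulVec_self_star (R := ℝ) x.ofLp
  exact h.smul hθ

lemma continuous_scaledOuter (θ : ℝ) : Continuous (scaledOuter (d := d) θ) := by
  refine Continuous.const_smul ?_ θ
  refine continuous_matrix fun i j => ?_
  simp only [vecMulVec_apply]
  fun_prop

lemma sum_scaledOuter {r : ℕ} (θ : ℝ) (z : Fin r → EuclideanSpace ℝ (Fin d)) :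
    ∑ k, scaledOuter θ (z k) = θ • ((matrixOfRows z)ᵀ * matrixOfRows z) := by
  simp only [scaledOuter, ← Finset.smul_sum]
  congr 1
  ext i j
  simp [Matrix.sum_apply, vecMulVec_apply, mul_apply, matrixOfRows]

/-- With `θ = c r / ‖A‖_F²`, a sampled outer product is `c` times the projection onto the line of
the sampled row: row-norm sampling makes all samples equally long. -/
lemma scaledOuter_sampleVec (hA : A ≠ 0) {r : ℕ} (hr : 0 < r) (c : ℝ) (i : Fin n)
    (hi : A i ≠ 0) :
    scaledOuter (c * r / frobeniusSq A) (sampleVec A r i) =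
      c • vecMulVec (‖rowVec A i‖⁻¹ • A i) (‖rowVec A i‖⁻¹ • A i) := by
  have hF := frobeniusSq_pos A hA
  have hr' : (0 : ℝ) < r := Nat.cast_pos.2 hr
  have hn := norm_rowVec_pos A hi
  have hs : Real.sqrt (r * rowProb A i) ^ 2 = r * rowProb A i :=
    Real.sq_sqrt (mul_nonneg hr'.le (rowProb_nonneg A i))
  have e : ∀ a : ℝ, vecMulVec (a • A i) (a • A i) = a ^ 2 • vecMulVec (A i) (A i) := fun a => by
    rw [smul_vecMulVec, vecMulVec_smul, smul_smul, sq]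
  have e' : (sampleVec A r i).ofLp = (Real.sqrt (r * rowProb A i))⁻¹ • A i := rfl
  rw [scaledOuter, e', e, e, smul_smul, smul_smul, inv_pow, inv_pow, hs, rowProb]
  congr 1
  field_simp

lemma unit_row_dotProduct_self (i : Fin n) (hi : A i ≠ 0) :
    (‖rowVec A i‖⁻¹ • A i) ⬝ᵥ (‖rowVec A i‖⁻¹ • A i) = 1 := by
  have hn := norm_rowVec_pos A hi
  rw [smul_dotProduct, dotProduct_smul, ← norm_rowVec_sq, smul_eq_mul, smul_eq_mul]
  field_simp

/-- One step of the matrix Chernoff bound: the expected trace exponential grows at most by the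
factor `1 + (e^c - 1) ‖A‖² / ‖A‖_F²`. -/
lemma sum_rowProb_trace_exp_le (hA : A ≠ 0) {r : ℕ} (hr : 0 < r) {c : ℝ} (hc : 0 ≤ c)
    {S : Matrix (Fin d) (Fin d) ℝ} (hS : S.PosSemidef) :
    ∑ i, rowProb A i *
        (exp (S + scaledOuter (c * r / frobeniusSq A) (sampleVec A r i))).trace ≤
      (1 + (Real.exp c - 1) * (‖A‖ ^ 2 / frobeniusSq A)) * (exp S).trace := by
  have hF := frobeniusSq_pos A hA
  have hterm : ∀ i, rowProb A i *
      (exp (S + scaledOuter (c * r / frobeniusSq A) (sampleVec A r i))).trace ≤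
      rowProb A i * (exp S).trace +
        (Real.exp c - 1) / frobeniusSq A * (A i ⬝ᵥ (exp S) *ᵥ A i) := by
    intro i
    by_cases hi : A i = 0
    · have : rowProb A i = 0 := by simp [rowProb, norm_rowVec_sq, hi]
      simp [this, hi]
    · have hp := unit_row_dotProduct_self A i hi
      have h := mul_le_mul_of_nonneg_left (trace_exp_add_rankOne_le hS hp hc) (rowProb_nonneg A i)
      rw [scaledOuter_sampleVec A hA hr c i hi]
      refine h.trans_eq ?_
      rw [mul_add]
      congr 1
      rw [mulVec_smul, smul_dotProduct, dotProduct_smul, smul_eq_mul, smul_eq_mul, rowProb]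
      have hn := norm_rowVec_pos A hi
      field_simp
  refine (Finset.sum_le_sum fun i _ => hterm i).trans ?_
  rw [Finset.sum_add_distrib, ← Finset.sum_mul, ← Finset.mul_sum, sum_rowProb A hA]
  have h := sum_row_dotProduct_mulVec_le A hS.exp
  have h2 : 0 ≤ (Real.exp c - 1) / frobeniusSq A :=
    div_nonneg (by linarith [Real.add_one_le_exp c]) hF.le
  calc _ ≤ 1 * (exp S).trace + (Real.exp c - 1) / frobeniusSq A * (‖A‖ ^ 2 * (exp S).trace) := by
        gcongr
    _ = _ := by ring

/-- One step of the scalar Chernoff bound in the direction `x`, where each summand of the quadratic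
form lies in `[0, c]`. -/
lemma sum_rowProb_exp_neg_le (hA : A ≠ 0) {r : ℕ} (hr : 0 < r) {c : ℝ} (hc : 0 ≤ c) (hc1 : c ≤ 1)
    {x : Fin d → ℝ} (hx : x ⬝ᵥ x = 1) :
    ∑ i, rowProb A i *
        Real.exp (-(x ⬝ᵥ scaledOuter (c * r / frobeniusSq A) (sampleVec A r i) *ᵥ x)) ≤
      1 - (1 - c) * c * (((A *ᵥ x) ⬝ᵥ (A *ᵥ x)) / frobeniusSq A) := by
  have hF := frobeniusSq_pos A hA
  have hterm : ∀ i, rowProb A i *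
      Real.exp (-(x ⬝ᵥ scaledOuter (c * r / frobeniusSq A) (sampleVec A r i) *ᵥ x)) ≤
      rowProb A i - (1 - c) * c / frobeniusSq A * ((A *ᵥ x) i * (A *ᵥ x) i) := by
    intro i
    by_cases hi : A i = 0
    · have : rowProb A i = 0 := by simp [rowProb, norm_rowVec_sq, hi]
      have h2 : (A *ᵥ x) i = 0 := by rw [mulVec, hi, zero_dotProduct]
      simp [this, h2]
    · have hn : 0 < ‖rowVec A i‖ := (norm_nonneg _).lt_of_ne fun h => hi (by
        have := norm_rowVec_sq A i
        rw [← h, zero_pow two_ne_zero] at this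
        exact dotProduct_self_eq_zero.1 this.symm)
      have hcs : (A *ᵥ x) i ^ 2 ≤ ‖rowVec A i‖ ^ 2 := by
        have h := real_inner_mul_inner_self_le (rowVec A i) (WithLp.toLp 2 x)
        rw [real_inner_self_eq_norm_sq, real_inner_self_eq_norm_sq,
          ← dotProduct_self_eq_norm_sq x, hx, mul_one] at h
        refine le_of_eq_of_le ?_ h
        rw [sq, EuclideanSpace.inner_eq_star_dotProduct]
        simp [mulVec, rowVec, dotProduct_comm]
      have hy : x ⬝ᵥ scaledOuter (c * r / frobeniusSq A) (sampleVec A r i) *ᵥ x =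
          c * ((A *ᵥ x) i ^ 2 / ‖rowVec A i‖ ^ 2) := by
        rw [scaledOuter_sampleVec A hA hr c i hi, smul_mulVec, dotProduct_smul, vecMulVec_mulVec]
        simp only [smul_dotProduct, smul_eq_mul, op_smul_eq_smul, dotProduct_comm x]
        rw [show A i ⬝ᵥ x = (A *ᵥ x) i from rfl]
        field_simp
      have ht1 : (A *ᵥ x) i ^ 2 / ‖rowVec A i‖ ^ 2 ≤ 1 := div_le_one_of_le₀ hcs (sq_nonneg _)
      have ht0 : 0 ≤ (A *ᵥ x) i ^ 2 / ‖rowVec A i‖ ^ 2 := by positivity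
      rw [hy]
      set t := (A *ᵥ x) i ^ 2 / ‖rowVec A i‖ ^ 2 with ht
      have hct : c * t ≤ c := mul_le_of_le_one_right hc ht1
      have hct0 : 0 ≤ c * t := mul_nonneg hc ht0
      -- From `|e^y - 1 - y| ≤ y²`, with one factor of `(c t)²` bounded by `c`.
      have hexp : Real.exp (-(c * t)) ≤ 1 - (1 - c) * (c * t) := by
        have h := (abs_le.1 (Real.abs_exp_sub_one_sub_id_le (x := -(c * t))
          (by rw [abs_neg, abs_of_nonneg hct0]; linarith))).2
        nlinarith [mul_le_mul_of_nonneg_right hct hct0]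
      refine (mul_le_mul_of_nonneg_left hexp (rowProb_nonneg A i)).trans_eq ?_
      rw [ht, rowProb]
      field_simp
  refine (Finset.sum_le_sum fun i _ => hterm i).trans_eq ?_
  rw [Finset.sum_sub_distrib, ← Finset.mul_sum, sum_rowProb A hA, dotProduct]
  ring

end RowSampling

/-! ### Tail bounds for the sampled matrix -/

section Tails

variable {n d : ℕ} (A : Matrix (Fin n) (Fin d) ℝ) {r : ℕ} {Ω : Type*} [MeasurableSpace Ω]
  {P : Measure Ω} [IsProbabilityMeasure P] {z : Fin r → Ω → EuclideanSpace ℝ (Fin d)}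

/-- Chernoff's method for a potential `g` of the sum `θ Ãᵀ Ã = ∑ₖ θ zₖ zₖᵀ`: a one-step growth factor
`exp a` and a lower bound `M` of the potential on the event `s` give `P s ≤ exp (r a) g(0) / M`. -/
lemma measureReal_le_of_one_step (hr : 0 < r)
    (hlaw : ∀ k, HasLaw (z k) (rowSamplingLaw A r) P) (hindep : iIndepFun z P)
    {θ : ℝ} (hθ : 0 ≤ θ) (g : Matrix (Fin d) (Fin d) ℝ → ℝ) (hg : Continuous g)
    (hg0 : ∀ S : Matrix (Fin d) (Fin d) ℝ, S.PosSemidef → 0 ≤ g S) {a : ℝ}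
    (hstep : ∀ S : Matrix (Fin d) (Fin d) ℝ, S.PosSemidef →
      ∑ i, rowProb A i * g (S + scaledOuter θ (sampleVec A r i)) ≤ Real.exp a * g S)
    {s : Set Ω} {M : ℝ} (hM : 0 < M)
    (hs : ∀ ω ∈ s, M ≤ g (θ • ((matrixOfRows fun k => z k ω)ᵀ * matrixOfRows fun k => z k ω))) :
    P.real s ≤ Real.exp (r * a) * g 0 / M := by
  have hprob : IsProbabilityMeasure (rowSamplingLaw A r) := by
    rw [← (hlaw ⟨0, hr⟩).map_eq]
    exact Measure.isProbabilityMeasure_map (hlaw ⟨0, hr⟩).aemeasurable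
  have hcont : ∀ (N : ℕ) (S : Matrix (Fin d) (Fin d) ℝ),
      Continuous fun w : Fin N → EuclideanSpace ℝ (Fin d) => g (S + ∑ k, scaledOuter θ (w k)) :=
    fun N S => hg.comp (continuous_const.add (continuous_finsetSum _ fun k _ =>
      (continuous_scaledOuter θ).comp (continuous_apply k)))
  have hz : AEMeasurable (fun ω k => z k ω) P :=
    aemeasurable_pi_lambda _ fun k => (hlaw k).aemeasurable
  have hmap : P.map (fun ω k => z k ω) = Measure.pi fun _ : Fin r => rowSamplingLaw A r := by
    rw [(iIndepFun_iff_map_fun_eq_pi_map fun k => (hlaw k).aemeasurable).1 hindep]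
    congr 1
    ext1 k
    exact (hlaw k).map_eq
  have hpsd : ∀ (S : Matrix (Fin d) (Fin d) ℝ), S.PosSemidef → ∀ x,
      (S + scaledOuter θ x).PosSemidef := fun S hS x => hS.add (scaledOuter_posSemidef hθ x)
  -- The potential is nonnegative only on the positive semidefinite cone, hence the truncation.
  have key := lintegral_pi_add_sum_le (rowSamplingLaw A r) (scaledOuter θ)
    (fun S => ENNReal.ofReal (max (g S) 0)) {S | S.PosSemidef} (ENNReal.ofReal (Real.exp a))
    (fun N S => ((hcont N S).max continuous_const).measurable.ennreal_ofReal) hpsd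
    (fun S hS => by
      rw [lintegral_rowSamplingLaw A r (fun x => max (g (S + scaledOuter θ x)) 0)
        fun x => le_max_right _ _, ← ENNReal.ofReal_mul (Real.exp_pos a).le,
        max_eq_left (hg0 S hS)]
      refine ENNReal.ofReal_le_ofReal (le_of_eq_of_le ?_ (hstep S hS))
      exact Finset.sum_congr rfl fun i _ => by rw [max_eq_left (hg0 _ (hpsd S hS _))])
    r 0 PosSemidef.zero
  rw [← hmap, lintegral_map' ((hcont r 0).max
    continuous_const).measurable.ennreal_ofReal.aemeasurable hz,
    ← ENNReal.ofReal_pow (Real.exp_pos a).le, ← Real.exp_nat_mul,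
    ← ENNReal.ofReal_mul (Real.exp_pos _).le, max_eq_left (hg0 0 PosSemidef.zero)] at key
  refine measureReal_le_div_of_lintegral_le P
    (((hcont r 0).max continuous_const).measurable.comp_aemeasurable hz) hM
    (mul_nonneg (Real.exp_pos _).le (hg0 0 PosSemidef.zero)) key fun ω hω => ?_
  refine (hs ω hω).trans ((le_of_eq ?_).trans (le_max_left _ _))
  rw [zero_add, sum_scaledOuter]

/-- Upper tail: the matrix Chernoff bound with the potential `S ↦ tr (exp S)`, which equals `d` at
`0` and dominates `exp ‖S‖`. -/
lemma measureReal_norm_sq_gt_le [NeZero d] (hA : A ≠ 0) (hr : 0 < r)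
    (hlaw : ∀ k, HasLaw (z k) (rowSamplingLaw A r) P) (hindep : iIndepFun z P)
    {ε : ℝ} (hε : 0 < ε) (hε1 : ε ≤ 1) :
    P.real {ω | (1 + ε) * ‖A‖ ^ 2 < ‖matrixOfRows (fun k => z k ω)‖ ^ 2} ≤
      d * Real.exp (-(r * (‖A‖ ^ 2 / frobeniusSq A)) * (ε ^ 2 / 4)) := by
  have hF := frobeniusSq_pos A hA
  set κ := ‖A‖ ^ 2 / frobeniusSq A with hκ
  have hκ0 : 0 ≤ κ := by positivity
  -- `e^c = 1 + ε` minimises the exponent `e^c - 1 - c (1 + ε)`.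
  set c := Real.log (1 + ε) with hc
  have hc0 : 0 ≤ c := Real.log_nonneg (by linarith)
  have hec : Real.exp c = 1 + ε := Real.exp_log (by linarith)
  have hθ : 0 ≤ c * r / frobeniusSq A := by positivity
  have hcont : Continuous fun S : Matrix (Fin d) (Fin d) ℝ => (exp S).trace := by
    let _ : NormedAlgebra ℚ (Matrix (Fin d) (Fin d) ℝ) := .restrictScalars ℚ ℝ _
    exact exp_continuous.matrix_trace
  have h := measureReal_le_of_one_step A hr hlaw hindep hθ (fun S => (exp S).trace)
    hcont
    (fun S hS => hS.exp.trace_nonneg) (a := ε * κ)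
    (fun S hS => (sum_rowProb_trace_exp_le A hA hr hc0 hS).trans
      (mul_le_mul_of_nonneg_right (by
        rw [hec, add_sub_cancel_left, add_comm]
        exact Real.add_one_le_exp _) hS.exp.trace_nonneg))
    (s := {ω | (1 + ε) * ‖A‖ ^ 2 < ‖matrixOfRows (fun k => z k ω)‖ ^ 2})
    (Real.exp_pos (c * r / frobeniusSq A * ((1 + ε) * ‖A‖ ^ 2)))
    (fun ω hω => (Real.exp_le_exp.2 (mul_le_mul_of_nonneg_left (le_of_lt hω) hθ)).trans
      (exp_l2_opNorm_sq_le_trace_exp _ _ hθ))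
  refine h.trans ?_
  simp only [exp_zero, trace_one, Fintype.card_fin]
  rw [mul_comm, mul_div_assoc, ← Real.exp_sub]
  refine mul_le_mul_of_nonneg_left (Real.exp_le_exp.2 ?_) (Nat.cast_nonneg d)
  have hlog : 2 * ε / (ε + 2) ≤ c := Real.le_log_one_add_of_nonneg hε.le
  have hnum : ε - c * (1 + ε) ≤ -(ε ^ 2 / 4) := by
    rw [div_le_iff₀ (by linarith)] at hlog
    nlinarith [mul_le_mul_of_nonneg_right hlog (by linarith : (0 : ℝ) ≤ 1 + ε), sq_nonneg ε,
      mul_nonneg (sq_nonneg ε) (sub_nonneg.2 hε1)]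
  calc (r : ℝ) * (ε * κ) - c * r / frobeniusSq A * ((1 + ε) * ‖A‖ ^ 2)
      = r * κ * (ε - c * (1 + ε)) := by rw [hκ]; ring
    _ ≤ r * κ * (-(ε ^ 2 / 4)) := mul_le_mul_of_nonneg_left hnum (by positivity)
    _ = -(r * κ) * (ε ^ 2 / 4) := by ring

/-- Lower tail: the norm is bounded below by its value in the direction `x` of the top right
singular vector of `A`, where the scalar Chernoff bound applies. -/
lemma measureReal_norm_sq_lt_le [NeZero d] (hA : A ≠ 0) (hr : 0 < r)
    (hlaw : ∀ k, HasLaw (z k) (rowSamplingLaw A r) P) (hindep : iIndepFun z P)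
    {ε : ℝ} (hε : 0 < ε) (hε1 : ε ≤ 1) :
    P.real {ω | ‖matrixOfRows (fun k => z k ω)‖ ^ 2 < (1 - ε) * ‖A‖ ^ 2} ≤
      Real.exp (-(r * (‖A‖ ^ 2 / frobeniusSq A)) * (ε ^ 2 / 4)) := by
  have hF := frobeniusSq_pos A hA
  obtain ⟨x, hx, hAx⟩ := exists_l2_opNorm_sq_le_mulVec A
  -- `c = ε / 2` minimises the exponent `-(1 - c) c + c (1 - ε)`.
  set c := ε / 2 with hc
  have hc0 : 0 ≤ c := by positivity
  have hc1 : c ≤ 1 := by linarith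
  have hθ : 0 ≤ c * r / frobeniusSq A := by positivity
  have hstep := sum_rowProb_exp_neg_le A hA hr hc0 hc1 hx
  have h := measureReal_le_of_one_step A hr hlaw hindep hθ
    (fun S => Real.exp (-(x ⬝ᵥ S *ᵥ x)))
    (Real.continuous_exp.comp ((continuous_const.dotProduct
      (continuous_id.matrix_mulVec continuous_const)).neg))
    (fun S _ => (Real.exp_pos _).le) (a := -((1 - c) * c * (‖A‖ ^ 2 / frobeniusSq A)))
    (fun S _ => by
      simp only [add_mulVec, dotProduct_add, neg_add, Real.exp_add]
      have e : ∀ i, rowProb A i * (Real.exp (-(x ⬝ᵥ S *ᵥ x)) *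
          Real.exp (-(x ⬝ᵥ scaledOuter (c * r / frobeniusSq A) (sampleVec A r i) *ᵥ x))) =
          rowProb A i *
          Real.exp (-(x ⬝ᵥ scaledOuter (c * r / frobeniusSq A) (sampleVec A r i) *ᵥ x)) *
          Real.exp (-(x ⬝ᵥ S *ᵥ x)) := fun i => by ring
      rw [Finset.sum_congr rfl fun i _ => e i, ← Finset.sum_mul]
      refine mul_le_mul_of_nonneg_right (hstep.trans ?_) (Real.exp_pos _).le
      have h1 : (1 - c) * c * (‖A‖ ^ 2 / frobeniusSq A) ≤
          (1 - c) * c * ((A *ᵥ x) ⬝ᵥ (A *ᵥ x) / frobeniusSq A) := by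
        have : 0 ≤ (1 - c) * c := mul_nonneg (by linarith) hc0
        gcongr
      linarith [Real.add_one_le_exp (-((1 - c) * c * (‖A‖ ^ 2 / frobeniusSq A)))])
    (s := {ω | ‖matrixOfRows (fun k => z k ω)‖ ^ 2 < (1 - ε) * ‖A‖ ^ 2})
    (Real.exp_pos (-(c * r / frobeniusSq A * ((1 - ε) * ‖A‖ ^ 2))))
    (fun ω hω => by
      refine Real.exp_le_exp.2 (neg_le_neg ?_)
      rw [smul_mulVec, dotProduct_smul, smul_eq_mul, ← mulVec_dotProduct_self]
      refine mul_le_mul_of_nonneg_left (le_trans ?_ (le_of_lt hω)) hθ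
      simpa [hx] using mulVec_dotProduct_self_le (matrixOfRows fun k => z k ω) x)
  refine h.trans_eq ?_
  simp only [zero_mulVec, dotProduct_zero, neg_zero, Real.exp_zero, mul_one]
  rw [← Real.exp_sub, hc]
  congr 1
  ring

end Tails

/-! ### The sampling theorem -/

/-- In this statement `‖·‖` is the spectral norm of a matrix (the operator norm between
Euclidean spaces). -/
theorem mainTheorem4 {n d : ℕ} (A : Matrix (Fin n) (Fin d) ℝ) (hA : A ≠ 0)
    (ε δ : ℝ) (hε : 0 < ε) (hε1 : ε ≤ 1) (hδ : 0 < δ)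
    (r : ℕ) (hr : 4 * (d : ℝ) / ε ^ 2 * Real.log (2 * (d : ℝ) / δ) ≤ (r : ℝ))
    {Ω : Type*} [MeasurableSpace Ω] (P : Measure Ω) [IsProbabilityMeasure P]
    (z : Fin r → Ω → EuclideanSpace ℝ (Fin d))
    (hlaw : ∀ k, HasLaw (z k) (rowSamplingLaw A r) P)
    (hindep : iIndepFun z P) :
    1 - δ ≤ P.real {ω | (1 - ε) * ‖A‖ ^ 2 ≤ ‖matrixOfRows (fun k => z k ω)‖ ^ 2 ∧
      ‖matrixOfRows (fun k => z k ω)‖ ^ 2 ≤ (1 + ε) * ‖A‖ ^ 2} := by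
  have hd : d ≠ 0 := by
    rintro rfl
    exact hA (Subsingleton.elim _ _)
  have : NeZero d := ⟨hd⟩
  have hd1 : (1 : ℝ) ≤ d := Nat.one_le_cast.2 (Nat.one_le_iff_ne_zero.2 hd)
  have hd0 : (0 : ℝ) < d := by linarith
  rcases Nat.eq_zero_or_pos r with rfl | hr0
  · -- With no samples the hypothesis forces `δ ≥ 2 d`.
    have hlog : Real.log (2 * d / δ) ≤ 0 := by
      by_contra! hlog
      have : 0 < 4 * (d : ℝ) / ε ^ 2 * Real.log (2 * d / δ) := by positivity
      rw [Nat.cast_zero] at hr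
      linarith
    rw [Real.log_nonpos_iff (by positivity), div_le_one hδ] at hlog
    exact le_trans (by linarith) measureReal_nonneg
  have hF := frobeniusSq_pos A hA
  have hup := measureReal_norm_sq_gt_le A hA hr0 hlaw hindep hε hε1
  have hlow := measureReal_norm_sq_lt_le A hA hr0 hlaw hindep hε hε1
  -- The stable rank `‖A‖_F² / ‖A‖²` is at most `d`, so the exponent is at least `ln (2d / δ)`.
  have hexp : Real.exp (-(r * (‖A‖ ^ 2 / frobeniusSq A)) * (ε ^ 2 / 4)) ≤ δ / (2 * d) := by
    have hκ : 1 / (d : ℝ) ≤ ‖A‖ ^ 2 / frobeniusSq A := by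
      rw [div_le_div_iff₀ hd0 hF]
      linarith [frobeniusSq_le A]
    have h1 : Real.log (2 * d / δ) ≤ r * (‖A‖ ^ 2 / frobeniusSq A) * (ε ^ 2 / 4) := by
      calc Real.log (2 * d / δ)
          = 4 * (d : ℝ) / ε ^ 2 * Real.log (2 * d / δ) * (1 / d) * (ε ^ 2 / 4) := by
            field_simp
        _ ≤ r * (1 / d) * (ε ^ 2 / 4) := by gcongr
        _ ≤ _ := by gcongr
    calc _ ≤ Real.exp (-Real.log (2 * d / δ)) := Real.exp_le_exp.2 (by linarith)
      _ = δ / (2 * d) := by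
        rw [Real.exp_neg, Real.exp_log (by positivity), inv_div]
  have hup' : d * Real.exp (-(r * (‖A‖ ^ 2 / frobeniusSq A)) * (ε ^ 2 / 4)) ≤ δ / 2 := by
    refine (mul_le_mul_of_nonneg_left hexp hd0.le).trans_eq ?_
    field_simp
  have hlow' : Real.exp (-(r * (‖A‖ ^ 2 / frobeniusSq A)) * (ε ^ 2 / 4)) ≤ δ / 2 :=
    (le_mul_of_one_le_left (Real.exp_pos _).le hd1).trans hup'
  set good := {ω | (1 - ε) * ‖A‖ ^ 2 ≤ ‖matrixOfRows (fun k => z k ω)‖ ^ 2 ∧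
      ‖matrixOfRows (fun k => z k ω)‖ ^ 2 ≤ (1 + ε) * ‖A‖ ^ 2} with hgood
  set bad₁ := {ω | (1 + ε) * ‖A‖ ^ 2 < ‖matrixOfRows (fun k => z k ω)‖ ^ 2}
  set bad₂ := {ω | ‖matrixOfRows (fun k => z k ω)‖ ^ 2 < (1 - ε) * ‖A‖ ^ 2}
  have hcover : good ∪ (bad₁ ∪ bad₂) = Set.univ := by
    refine Set.eq_univ_of_forall fun ω => ?_
    by_cases h1 : ω ∈ bad₁
    · exact Or.inr (Or.inl h1)
    by_cases h2 : ω ∈ bad₂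
    · exact Or.inr (Or.inr h2)
    · exact Or.inl ⟨not_lt.1 h2, not_lt.1 h1⟩
  have hunion := measureReal_union_le (μ := P) good (bad₁ ∪ bad₂)
  have hunion' := measureReal_union_le (μ := P) bad₁ bad₂
  rw [hcover, probReal_univ] at hunion
  linarith
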